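/- Let $n\ge 0$ be an integer and let $T\colon \mathbb{R}^n\times X\to X$, $(t,x)\mapsto T^t x$, be a continuous action of the additive group $\mathbb{R}^n$ (with its Euclidean topology) on a compact metrizable space $X$. Let $\mathrm{Fix}(X,T)=\{x\in X \mid T^t x=x \text{ for all } t\in\mathbb{R}^n\}$, and let $\mathrm{Lip}_1(\mathbb{R}^n,[0,1])$ be the space of all maps $\varphi\colon\mathbb{R}^n\to[0,1]$ with $|\varphi(t)-\varphi(u)|\le |t-u|$ for all $t,u\in\mathbb{R}^n$, where $|t-u|$ is the Euclidean norm, endowed with the compact-open topology and with the shift action $(\sigma^u\varphi)(t)=\varphi(t+u)$ of $\mathbb{R}^n$. Then there is a topological embedding $f\colon X\to \mathrm{Lip}_1(\mathbb{R}^n,[0,1])$ with $f\circ T^t=\sigma^t\circ f$ for all $t\in\mathbb{R}^n$ if and only if $\mathrm{Fix}(X,T)$ topologically embeds in $[0,1]$. -/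

import Mathlib

open Topology

/-- The space `Lip_1(ℝⁿ, [0,1])` of one-Lipschitz maps from Euclidean `ℝⁿ` to the unit interval.
As a subtype of `C(ℝⁿ, [0,1])` it carries the compact-open topology. -/
abbrev LipOne (n : ℕ) : Type :=
  {φ : C(EuclideanSpace ℝ (Fin n), unitInterval) // LipschitzWith 1 φ}

/-- The shift `σ_u`, sending `φ` to the function `t ↦ φ (t + u)`. -/
def LipOne.shift {n : ℕ} (u : EuclideanSpace ℝ (Fin n)) (φ : LipOne n) : LipOne n :=
  ⟨⟨fun t => φ.1 (t + u), φ.1.continuous.comp (continuous_id.add continuous_const)⟩, by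
    intro s t
    have h := φ.2 (s + u) (t + u)
    rwa [edist_add_right] at h⟩

/-- Equivariant embedding of `(X, T)`, where the action is
`T_t x = t +ᵥ x`, into the shift on `Lip_1(ℝⁿ, [0,1])`: a topological embedding `f` with
`f ∘ T_t = σ_t ∘ f` for all `t`. -/
def EquivariantlyEmbedsInLipOne (n : ℕ) (X : Type*) [TopologicalSpace X]
    [AddAction (EuclideanSpace ℝ (Fin n)) X] : Prop :=
  ∃ f : X → LipOne n, IsEmbedding f ∧
    ∀ (t : EuclideanSpace ℝ (Fin n)) (x : X), f (t +ᵥ x) = LipOne.shift t (f x)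

open Set Filter Metric

/-! ### Infimal convolution along orbits -/

section Flow

variable {V X : Type*} [NormedAddCommGroup V] [AddAction V X]

/-! An equivariant map into `LipOne n` is induced by one function `F` on `X`, 1-Lipschitz along
orbits, via `x ↦ (t ↦ F (t +ᵥ x))`; it is injective iff `F` separates orbit maps. Images of fixed
points are constant functions, so evaluation at `0` gives necessity. For sufficiency, extend a given
embedding of the fixed points and apply Baire's theorem to the complete space of 1-Lipschitz
extensions. Density is the core (`exists_nhds_separating_perturbation`): after gaining Lipschitz
slack, add a small, rapidly oscillating function near `x₀` and restore the Lipschitz bound by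
infimal convolution with the norm. If `x` and `y` were still not separated, the convolution would be
inactive near `x`, and the oscillation would be a difference of two Lipschitz functions, which it is
too steep to be. -/

/-- The infimal convolution of `k` with `lam * ‖·‖` along the orbits is continuous and attained. -/
theorem exists_orbit_infConv [ProperSpace V]
    [TopologicalSpace X] [CompactSpace X] [ContinuousVAdd V X]
    (k : C(X, ℝ)) {lam : ℝ} (hlam : 0 < lam) :
    ∃ F : C(X, ℝ), (∀ (x : X) (t : V), F x ≤ k (t +ᵥ x) + lam * ‖t‖) ∧
      ∀ x : X, ∃ s : V, F x = k (s +ᵥ x) + lam * ‖s‖ := by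
  -- Beyond radius `R` the penalty exceeds the oscillation of `k`, so `t = 0` does better and the
  -- infimum may be taken over a compact ball.
  set R : ℝ := 2 * ‖k‖ / lam with hR
  have hR0 : 0 ≤ R := by positivity
  have hK : IsCompact (closedBall (0 : V) R) := isCompact_closedBall 0 R
  let q : X → V → ℝ := fun x t => k (t +ᵥ x) + lam * ‖t‖
  have hq : Continuous ↿q := by
    change Continuous fun p : X × V => k (p.2 +ᵥ p.1) + lam * ‖p.2‖
    fun_prop
  have hqx (x : X) : Continuous (q x) := by
    change Continuous fun t : V => k (t +ᵥ x) + lam * ‖t‖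
    fun_prop
  have hle (x : X) (t : V) (ht : t ∈ closedBall (0 : V) R) :
      sInf (q x '' closedBall 0 R) ≤ q x t :=
    csInf_le (hK.image (hqx x)).bddBelow (mem_image_of_mem _ ht)
  have hb (x : X) : |k x| ≤ ‖k‖ := k.norm_coe_le_norm x
  refine ⟨⟨fun x => sInf (q x '' closedBall 0 R), hK.continuous_sInf hq⟩, fun x t => ?_,
    fun x => ?_⟩
  · by_cases ht : t ∈ closedBall (0 : V) R
    · exact hle x t ht
    · have h0 := hle x 0 (by simpa using hR0)
      simp only [q, zero_vadd, norm_zero, mul_zero, add_zero] at h0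
      rw [mem_closedBall_zero_iff, not_le, hR, div_lt_iff₀ hlam] at ht
      have h1 := abs_le.1 (hb x)
      have h2 := abs_le.1 (hb (t +ᵥ x))
      refine h0.trans ?_
      linarith
  · obtain ⟨s, -, hs⟩ := hK.exists_sInf_image_eq ⟨0, by simpa using hR0⟩ (hqx x).continuousOn
    exact ⟨s, hs⟩

/-- `F` is `lam`-Lipschitz along the orbits of the action of `V`. -/
def OrbitLipschitz (V : Type*) {X : Type*} [NormedAddCommGroup V] [AddAction V X] (lam : ℝ)
    (F : X → ℝ) : Prop :=
  ∀ (t : V) (x : X), F x ≤ F (t +ᵥ x) + lam * ‖t‖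

theorem OrbitLipschitz.sub_le {lam : ℝ} {F : X → ℝ} (hF : OrbitLipschitz V lam F) (s t : V)
    (x : X) : F (s +ᵥ x) - F (t +ᵥ x) ≤ lam * ‖s - t‖ := by
  have h := hF (t - s) (s +ᵥ x)
  rw [vadd_vadd, sub_add_cancel, norm_sub_rev] at h
  linarith

theorem OrbitLipschitz.of_infConv {lam : ℝ} (hlam : 0 < lam) {F k : X → ℝ}
    (h1 : ∀ (x : X) (t : V), F x ≤ k (t +ᵥ x) + lam * ‖t‖)
    (h2 : ∀ x : X, ∃ s : V, F x = k (s +ᵥ x) + lam * ‖s‖) : OrbitLipschitz V lam F := by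
  intro t x
  obtain ⟨s, hs⟩ := h2 (t +ᵥ x)
  have h := h1 x (s + t)
  rw [vadd_vadd] at hs
  have h3 := mul_le_mul_of_nonneg_left (norm_add_le s t) hlam.le
  linarith

/-! ### Local perturbation by oscillation -/

/-- There are uniformly small functions of one variable whose composition with any path from
above `3/4` to below `1/4` violates a given Lipschitz bound. -/
theorem exists_oscillating {ε L : ℝ} (hε : 0 < ε) (hL : 0 < L) :
    ∃ θ : C(ℝ, ℝ), θ 0 = 0 ∧ (∀ u, 0 ≤ θ u ∧ θ u ≤ ε) ∧
      ∀ p : ℝ → ℝ, Continuous p → 3 / 4 ≤ p 0 → p 1 ≤ 1 / 4 →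
        ∃ s ∈ Icc (0 : ℝ) 1, ∃ t ∈ Icc (0 : ℝ) 1, L * |s - t| < θ (p s) - θ (p t) := by
  obtain ⟨N, hN⟩ := exists_nat_gt (L / ε)
  have hN0 : (0 : ℝ) < N := (div_pos hL hε).trans hN
  rw [div_lt_iff₀ hε] at hN
  let θ : C(ℝ, ℝ) := ⟨fun u => ε * ((1 - Real.cos (4 * N * u * Real.pi)) / 2), by fun_prop⟩
  have hθ (u : ℝ) : θ u = ε * ((1 - Real.cos (4 * N * u * Real.pi)) / 2) := rfl
  refine ⟨θ, by simp [hθ], fun u => ?_, fun p hp hp0 hp1 => ?_⟩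
  · have h1 := Real.cos_le_one (4 * N * u * Real.pi)
    have h2 := Real.neg_one_le_cos (4 * N * u * Real.pi)
    rw [hθ]
    exact ⟨mul_nonneg hε.le (by linarith), mul_le_of_le_one_right hε.le (by linarith)⟩
  · by_contra! hcon
    -- The levels descend from `3/4` to `1/4` in `2N` steps, and `θ` alternates between `0` and `ε`
    -- on them. Under the Lipschitz bound each step costs time `ε / L`, too much in total.
    let v : ℕ → ℝ := fun k => (3 * N - k) / (4 * N)
    have hv (k : ℕ) : θ (v k) = ε * ((1 - (-1) ^ (3 * (N : ℤ) - k)) / 2) := by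
      rw [hθ, ← Real.cos_int_mul_pi]
      congr 5
      push_cast
      simp only [v]
      field_simp
    have hstep (k : ℕ) : |θ (v k) - θ (v (k + 1))| = ε := by
      rw [hv, hv]
      have : (3 * (N : ℤ) - k) = (3 * (N : ℤ) - (k + 1 : ℕ)) + 1 := by push_cast; ring
      rw [this, zpow_add_one₀ (by norm_num)]
      rcases Int.even_or_odd (3 * (N : ℤ) - (k + 1 : ℕ)) with h | h
      · rw [h.neg_one_zpow]; norm_num [abs_of_pos hε]
      · rw [h.neg_one_zpow]; norm_num [abs_of_pos hε]
    have hmain (k : ℕ) : k ≤ 2 * N → ∃ s ∈ Icc (0 : ℝ) 1, k * ε ≤ L * s ∧ p s = v k := by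
      induction k with
      | zero =>
        intro _
        have hv0 : v 0 = 3 / 4 := by simp only [v]; field_simp; simp
        obtain ⟨s, hs, hps⟩ := intermediate_value_Icc' zero_le_one hp.continuousOn
          (show v 0 ∈ Icc (p 1) (p 0) from ⟨by linarith, by linarith⟩)
        exact ⟨s, hs, by simpa using mul_nonneg hL.le hs.1, hps⟩
      | succ k ih =>
        intro hk
        obtain ⟨s, hs, hks, hps⟩ := ih (by omega)
        have hv1 : v (k + 1) ≤ v k := by
          simp only [v]; gcongr; simp
        have hv2 : 1 / 4 ≤ v (k + 1) := by
          have : ((k + 1 : ℕ) : ℝ) ≤ 2 * N := by exact_mod_cast hk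
          simp only [v]
          rw [div_le_div_iff₀ (by norm_num) (by positivity)]
          linarith
        obtain ⟨t, ht, hpt⟩ := intermediate_value_Icc' hs.2 hp.continuousOn
          (show v (k + 1) ∈ Icc (p 1) (p s) from ⟨by linarith, by linarith⟩)
        have ht' : t ∈ Icc (0 : ℝ) 1 := ⟨hs.1.trans ht.1, ht.2⟩
        refine ⟨t, ht', ?_, hpt⟩
        have h1 := hcon s hs t ht'
        have h2 := hcon t ht' s hs
        rw [abs_sub_comm, abs_of_nonneg (sub_nonneg.2 ht.1)] at h1
        rw [abs_of_nonneg (sub_nonneg.2 ht.1)] at h2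
        have h3 : ε ≤ L * (t - s) := by
          rw [← hstep k, ← hps, ← hpt]
          exact abs_le.2 ⟨by linarith, by linarith⟩
        push_cast
        linarith
    obtain ⟨s, hs, hks, -⟩ := hmain (2 * N) le_rfl
    have := mul_le_mul_of_nonneg_left hs.2 hL.le
    push_cast at hks
    nlinarith

/-- A stabilizer containing a ball is everything, since `t` is `N` times the small vector `t / N`.
-/
theorem exists_small_vadd_ne [NormedSpace ℝ V]
    {x : X} (hx : x ∉ AddAction.fixedPoints V X) {r : ℝ} (hr : 0 < r) :
    ∃ t : V, ‖t‖ ≤ r ∧ t +ᵥ x ≠ x := by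
  by_contra! h
  refine hx fun t => ?_
  obtain ⟨N, hN⟩ := exists_nat_gt (‖t‖ / r)
  have hN0 : (0 : ℝ) < N := (div_nonneg (norm_nonneg t) hr.le).trans_lt hN
  have hmem : (N : ℝ)⁻¹ • t ∈ AddAction.stabilizer V x := by
    refine h _ ?_
    rw [norm_smul, norm_inv, Real.norm_natCast, inv_mul_le_iff₀ hN0]
    exact ((div_lt_iff₀ hr).1 hN).le
  have := (AddAction.stabilizer V x).nsmul_mem hmem N
  rwa [← Nat.cast_smul_eq_nsmul ℝ, smul_inv_smul₀ hN0.ne'] at this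

theorem isClosed_addAction_fixedPoints [TopologicalSpace X] [T2Space X] [ContinuousVAdd V X] :
    IsClosed (AddAction.fixedPoints V X) := by
  have : AddAction.fixedPoints V X = ⋂ t : V, {x | t +ᵥ x = x} := by
    ext x; simp [AddAction.mem_fixedPoints]
  rw [this]
  exact isClosed_iInter fun t => isClosed_eq (continuous_const_vadd t) continuous_id

/-- Around two distinct points, the first of which is not fixed, any function that is strictly
better than `1`-Lipschitz along orbits can be perturbed to separate all orbits. -/
theorem exists_nhds_separating_perturbation [NormedSpace ℝ V] [ProperSpace V]
    [TopologicalSpace X] [CompactSpace X] [T2Space X] [ContinuousVAdd V X]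
    {x₀ y₀ : X} (hne : x₀ ≠ y₀)
    (hx₀ : x₀ ∉ AddAction.fixedPoints V X) :
    ∃ A ∈ 𝓝 x₀, ∃ B ∈ 𝓝 y₀, IsClosed A ∧ IsClosed B ∧
      ∀ (c ε : ℝ) (F : C(X, ℝ)), 0 < c → 0 < ε → OrbitLipschitz V (1 - c) F →
        ∃ F' : C(X, ℝ), OrbitLipschitz V 1 F' ∧ (∀ x, F x ≤ F' x ∧ F' x ≤ F x + ε) ∧
          (∀ x ∈ AddAction.fixedPoints V X, F' x = F x) ∧
          ∀ x ∈ A, ∀ y ∈ B, ∃ t : V, F' (t +ᵥ x) ≠ F' (t +ᵥ y) := by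
  obtain ⟨r, hr, hry⟩ : ∃ r > 0, ∀ t : V, ‖t‖ ≤ 2 * r → t +ᵥ y₀ ≠ x₀ := by
    have hopen : IsOpen {t : V | t +ᵥ y₀ ≠ x₀} :=
      isOpen_ne_fun (by fun_prop) continuous_const
    obtain ⟨ρ, hρ, hsub⟩ := Metric.isOpen_iff.1 hopen 0 (by simpa using hne.symm)
    refine ⟨ρ / 4, by positivity, fun t ht => hsub ?_⟩
    rw [mem_ball_zero_iff]
    linarith
  obtain ⟨t₀, ht₀, ht₀x⟩ := exists_small_vadd_ne hx₀ hr
  have hK : IsCompact (closedBall (0 : V) (2 * r)) := isCompact_closedBall _ _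
  -- Vanishing on `C` keeps the values at fixed points, leaves the orbit piece of `y₀` untouched,
  -- and makes the bump drop from `1` to `0` between `x₀` and `t₀ +ᵥ x₀`.
  let C : Set X := (fun t : V => t +ᵥ y₀) '' closedBall 0 (2 * r) ∪
    (AddAction.fixedPoints V X ∪ {t₀ +ᵥ x₀})
  have hC : IsClosed C := (hK.image (by fun_prop)).isClosed.union
    (isClosed_addAction_fixedPoints.union isClosed_singleton)
  have hxC : Disjoint C {x₀} := by
    rw [disjoint_singleton_right]
    rintro (⟨t, ht, h⟩ | h | h)
    · exact hry t (mem_closedBall_zero_iff.1 ht) h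
    · exact hx₀ h
    · exact ht₀x (mem_singleton_iff.1 h).symm
  obtain ⟨φ, hφ0, hφ1, -⟩ := exists_continuous_zero_one_of_isClosed hC isClosed_singleton hxC
  replace hφ1 : φ x₀ = 1 := hφ1 rfl
  -- Truncation makes `ψ` vanish on orbit pieces of all `y` near `y₀`, not only of `y₀`.
  let ψ : C(X, ℝ) := ⟨fun x => max 0 (2 * φ x - 1), by fun_prop⟩
  have hψ (x : X) : ψ x = max 0 (2 * φ x - 1) := rfl
  have hψ0 {x : X} (h : φ x ≤ 1 / 2) : ψ x = 0 := by
    rw [hψ]; exact max_eq_left (by linarith)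
  have hψC {x : X} (h : x ∈ C) : ψ x = 0 := hψ0 (by rw [hφ0 h]; norm_num)
  have hψ1 : ψ x₀ = 1 := by rw [hψ, hφ1]; norm_num
  refine ⟨{x | 3 / 4 ≤ ψ x ∧ ψ (t₀ +ᵥ x) ≤ 1 / 4}, ?_,
    {y | ∀ t ∈ closedBall (0 : V) (2 * r), φ (t +ᵥ y) ≤ 1 / 2}, ?_, ?_, ?_, ?_⟩
  · have h1 : ∀ᶠ x in 𝓝 x₀, 3 / 4 < ψ x :=
      ψ.continuous.continuousAt.eventually_const_lt (by rw [hψ1]; norm_num)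
    have h2 : ∀ᶠ x in 𝓝 x₀, ψ (t₀ +ᵥ x) < 1 / 4 := by
      have : Continuous fun x => ψ (t₀ +ᵥ x) := by fun_prop
      refine this.continuousAt.eventually_lt_const ?_
      change ψ (t₀ +ᵥ x₀) < 1 / 4
      rw [hψC (.inr (.inr rfl))]; norm_num
    filter_upwards [h1, h2] with x h1 h2 using ⟨h1.le, h2.le⟩
  · refine hK.eventually_forall_of_forall_eventually fun t ht => ?_
    have hc : Continuous fun p : X × V => φ (p.2 +ᵥ p.1) := by fun_prop
    have h0 : φ (t +ᵥ y₀) = 0 := hφ0 (.inl (mem_image_of_mem _ ht))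
    have := (hc.continuousAt (x := (y₀, t))).eventually_lt_const (u := 1 / 2)
      (show φ (t +ᵥ y₀) < 1 / 2 by rw [h0]; norm_num)
    filter_upwards [this] with p hp using hp.le
  · have hc : Continuous fun x => ψ (t₀ +ᵥ x) := by fun_prop
    exact (isClosed_le continuous_const ψ.continuous).inter (isClosed_le hc continuous_const)
  · simp only [ofPred_forall]
    exact isClosed_biInter fun t _ => isClosed_le (by fun_prop) continuous_const
  · intro c ε₀ F hc hε₀ hF
    -- A minimiser `s` satisfies `c * ‖s‖ ≤ ε`, so `ε ≤ c * r` keeps it in the ball of radius `r`.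
    obtain ⟨ε, hε, hεε₀, hεr⟩ : ∃ ε > 0, ε ≤ ε₀ ∧ ε ≤ c * r :=
      ⟨min ε₀ (c * r), lt_min hε₀ (by positivity), min_le_left _ _, min_le_right _ _⟩
    obtain ⟨θ, hθ0, hθ, hosc⟩ := exists_oscillating hε (mul_pos two_pos hr)
    let w : C(X, ℝ) := θ.comp ψ
    have hw (x : X) : w x = θ (ψ x) := rfl
    have hw0 (x : X) : 0 ≤ w x := (hθ _).1
    have hwε (x : X) : w x ≤ ε := (hθ _).2
    obtain ⟨F', h1, h2⟩ := exists_orbit_infConv (V := V) (F + w) one_pos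
    have hlow (x : X) (s : V) (hs : F' x = (F + w) (s +ᵥ x) + 1 * ‖s‖) :
        F x + c * ‖s‖ ≤ F' x := by
      have h3 := hF s x
      have h4 := hw0 (s +ᵥ x)
      rw [hs, ContinuousMap.add_apply]
      linarith
    have hup (x : X) : F' x ≤ F x + w x := by simpa using h1 x 0
    have hle (x : X) : F x ≤ F' x := by
      obtain ⟨s, hs⟩ := h2 x
      have := hlow x s hs
      have : 0 ≤ c * ‖s‖ := by positivity
      linarith
    have heq {x : X} (hx : ψ x = 0) : F' x = F x := by
      refine le_antisymm ?_ (hle x)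
      have := hup x
      rwa [hw, hx, hθ0, add_zero] at this
    refine ⟨F', .of_infConv one_pos h1 h2, fun x => ⟨hle x, ?_⟩,
      fun x hx => heq (hψC (.inr (.inl hx))), ?_⟩
    · linarith [hup x, hwε x]
    rintro x ⟨hx1, hx2⟩ y hy
    by_contra! hxy
    have hxy' (t : V) (ht : ‖t‖ ≤ 2 * r) : F' (t +ᵥ x) = F (t +ᵥ y) := by
      rw [hxy, heq (hψ0 (hy t (mem_closedBall_zero_iff.2 ht)))]
    -- Near `x`, `F'` copies `F` near `y` and so has slope at most `1 - c`; a minimiser `s ≠ 0`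
    -- would force slope `1`.
    have hkey (t : V) (ht : ‖t‖ ≤ r) : F (t +ᵥ y) = F (t +ᵥ x) + w (t +ᵥ x) := by
      rw [← hxy' t (by linarith)]
      obtain ⟨s, hs⟩ := h2 (t +ᵥ x)
      have h3 := hlow _ s hs
      have h4 := hup (t +ᵥ x)
      have h5 := hwε (t +ᵥ x)
      have h6 : ‖s‖ ≤ r := le_of_mul_le_mul_left (by linarith) hc
      have h7 : F' ((s + t) +ᵥ x) ≤ (F + w) (s +ᵥ (t +ᵥ x)) := by
        rw [vadd_vadd]; simpa using h1 ((s + t) +ᵥ x) 0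
      rw [hxy' _ ((norm_add_le s t).trans (by linarith))] at h7
      have h8 := hF.sub_le t (s + t) y
      rw [sub_add_cancel_right, norm_neg] at h8
      rw [← hxy' t (by linarith)] at h8
      have h9 : ‖s‖ = 0 := by
        have : c * ‖s‖ ≤ 0 := by linarith
        exact le_antisymm (nonpos_of_mul_nonpos_right this hc) (norm_nonneg s)
      rw [norm_eq_zero.1 h9] at hs
      simpa using hs
    -- By `hkey`, `w` is a difference of two `(1 - c)`-Lipschitz functions on this segment,
    -- contradicting oscillation at rate `2 * r`.
    obtain ⟨s, hs, t, ht, hst⟩ := hosc (fun u => ψ ((u • t₀) +ᵥ x)) (by fun_prop)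
      (by simpa using hx1) (by simpa using hx2)
    have hn {u : ℝ} (hu : u ∈ Icc (0 : ℝ) 1) : ‖u • t₀‖ ≤ r := by
      rw [norm_smul, Real.norm_of_nonneg hu.1]
      exact (mul_le_of_le_one_left (norm_nonneg _) hu.2).trans ht₀
    have k1 := hkey _ (hn hs)
    have k2 := hkey _ (hn ht)
    have k3 := hF.sub_le (s • t₀) (t • t₀) y
    have k4 := hF.sub_le (t • t₀) (s • t₀) x
    rw [norm_sub_rev] at k4
    rw [← sub_smul, norm_smul, Real.norm_eq_abs] at k3 k4
    rw [← hw, ← hw] at hst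
    have k5 : 0 ≤ |s - t| * ‖t₀‖ := by positivity
    have k6 : |s - t| * ‖t₀‖ ≤ |s - t| * r := by gcongr
    nlinarith [mul_nonneg hc.le k5]

/-! ### Baire category argument -/

/-- The functions from `X` to `[0, 1]` that are `1`-Lipschitz along orbits and extend `h`. -/
def orbitLipschitzExtensions (V : Type*) {X : Type*} [NormedAddCommGroup V]
    [TopologicalSpace X] [AddAction V X] (h : AddAction.fixedPoints V X → ℝ) : Set C(X, ℝ) :=
  {F | OrbitLipschitz V 1 F ∧ (∀ x, F x ∈ Icc (0 : ℝ) 1) ∧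
    ∀ x : AddAction.fixedPoints V X, F x = h x}

theorem isClosed_orbitLipschitzExtensions [TopologicalSpace X]
    (h : AddAction.fixedPoints V X → ℝ) :
    IsClosed (orbitLipschitzExtensions V h) := by
  have hev (x : X) : Continuous fun F : C(X, ℝ) => F x := continuous_eval_const x
  simp only [orbitLipschitzExtensions, OrbitLipschitz, ofPred_and, ofPred_forall]
  refine IsClosed.inter ?_ (IsClosed.inter ?_ ?_)
  · exact isClosed_iInter fun t => isClosed_iInter fun x =>
      isClosed_le (hev _) ((hev _).add continuous_const)
  · exact isClosed_iInter fun x => isClosed_Icc.preimage (hev x)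
  · exact isClosed_iInter fun x => isClosed_eq (hev _) continuous_const

theorem isOpen_setOf_separating [TopologicalSpace X] [CompactSpace X] [ContinuousVAdd V X]
    {A B : Set X} (hA : IsCompact A) (hB : IsCompact B) :
    IsOpen {F : C(X, ℝ) | ∀ x ∈ A, ∀ y ∈ B, ∃ t : V, F (t +ᵥ x) ≠ F (t +ᵥ y)} := by
  have : {F : C(X, ℝ) | ∀ x ∈ A, ∀ y ∈ B, ∃ t : V, F (t +ᵥ x) ≠ F (t +ᵥ y)} =
      {F : C(X, ℝ) | ∀ p ∈ A ×ˢ B, ∃ t : V, F (t +ᵥ p.1) ≠ F (t +ᵥ p.2)} := by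
    ext F
    simp only [mem_ofPred_eq, mem_prod, Prod.forall]
    exact ⟨fun h x y hxy => h x hxy.1 y hxy.2, fun h x hx y hy => h x y ⟨hx, hy⟩⟩
  rw [this, isOpen_iff_eventually]
  intro F hF
  refine (hA.prod hB).eventually_forall_of_forall_eventually fun p hp => ?_
  obtain ⟨t, ht⟩ := hF p hp
  have hopen : IsOpen {q : C(X, ℝ) × (X × X) | q.1 (t +ᵥ q.2.1) ≠ q.1 (t +ᵥ q.2.2)} :=
    isOpen_ne_fun (by fun_prop) (by fun_prop)
  filter_upwards [hopen.mem_nhds (show (F, p) ∈ _ from ht)] with q hq using ⟨t, hq⟩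

/-- Convolving a Tietze extension changes nothing at fixed points, whose orbits are trivial. -/
theorem exists_orbitLipschitz_half_extension [ProperSpace V]
    [TopologicalSpace X] [CompactSpace X] [T2Space X] [ContinuousVAdd V X]
    {h : AddAction.fixedPoints V X → ℝ}
    (hh : Continuous h) (hI : ∀ x, h x ∈ Icc (1 / 3 : ℝ) (2 / 3)) :
    ∃ F : C(X, ℝ), OrbitLipschitz V (1 / 2) F ∧ (∀ x, F x ∈ Icc (1 / 3 : ℝ) (2 / 3)) ∧
      ∀ x : AddAction.fixedPoints V X, F x = h x := by
  obtain ⟨k, hk, hkh⟩ := ContinuousMap.exists_restrict_eq_forall_mem_of_closed ⟨h, hh⟩ hI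
    ⟨1 / 3, by norm_num⟩ (isClosed_addAction_fixedPoints (V := V) (X := X))
  obtain ⟨F, h1, h2⟩ := exists_orbit_infConv (V := V) k (one_half_pos (α := ℝ))
  refine ⟨F, .of_infConv one_half_pos h1 h2, fun x => ⟨?_, ?_⟩, fun x => ?_⟩
  · obtain ⟨s, hs⟩ := h2 x
    have := (hk (s +ᵥ x)).1
    have := norm_nonneg s
    linarith
  · have := h1 x 0
    simp only [zero_vadd, norm_zero, mul_zero, add_zero] at this
    exact this.trans (hk x).2
  · have hkx : k x = h x := DFunLike.congr_fun hkh x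
    obtain ⟨s, hs⟩ := h2 x
    rw [x.2 s] at hs
    have h3 := h1 x 0
    simp only [zero_vadd, norm_zero, mul_zero, add_zero] at h3
    have := norm_nonneg s
    rw [← hkx]
    linarith

/-- Density of the functions separating the orbits of two compact sets. -/
theorem dense_separating [ProperSpace V]
    [TopologicalSpace X] [CompactSpace X] [T2Space X] [ContinuousVAdd V X]
    {A B : Set X} {h : AddAction.fixedPoints V X → ℝ}
    (hh : Continuous h) (hI : ∀ x, h x ∈ Icc (1 / 3 : ℝ) (2 / 3))
    (hAB : ∀ (c ε : ℝ) (F : C(X, ℝ)), 0 < c → 0 < ε → OrbitLipschitz V (1 - c) F →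
        ∃ F' : C(X, ℝ), OrbitLipschitz V 1 F' ∧ (∀ x, F x ≤ F' x ∧ F' x ≤ F x + ε) ∧
          (∀ x ∈ AddAction.fixedPoints V X, F' x = F x) ∧
          ∀ x ∈ A, ∀ y ∈ B, ∃ t : V, F' (t +ᵥ x) ≠ F' (t +ᵥ y)) :
    Dense {F : orbitLipschitzExtensions V h |
      ∀ x ∈ A, ∀ y ∈ B, ∃ t : V, F.1 (t +ᵥ x) ≠ F.1 (t +ᵥ y)} := by
  rw [Metric.dense_iff]
  rintro ⟨F, hF, hF01, hFh⟩ ρ hρ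
  obtain ⟨F₁, hL₁, hI₁, hh₁⟩ := exists_orbitLipschitz_half_extension hh hI
  obtain ⟨δ, hδ, hδ1, hδρ⟩ : ∃ δ > 0, δ < 1 ∧ δ * 2 < ρ := by
    refine ⟨min (1 / 2) (ρ / 4), by positivity, ?_, ?_⟩
    · exact (min_le_left _ _).trans_lt (by norm_num)
    · linarith [min_le_right (1 / 2) (ρ / 4)]
  -- Mixing in `F₁` gains Lipschitz slack `δ / 2` and room `δ / 3` below `1`.
  let G : C(X, ℝ) := (1 - δ) • F + δ • F₁
  have hG (x : X) : G x = (1 - δ) * F x + δ * F₁ x := rfl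
  have hGL : OrbitLipschitz V (1 - δ / 2) G := by
    intro t x
    have h1 := mul_le_mul_of_nonneg_left (hF t x) (sub_nonneg.2 hδ1.le)
    have h2 := mul_le_mul_of_nonneg_left (hL₁ t x) hδ.le
    rw [hG, hG]
    linarith
  obtain ⟨F', hL', hGF', hfix, hsep⟩ := hAB (δ / 2) (δ / 3) G (by positivity) (by positivity) hGL
  have hb (x : X) : |F' x - F x| ≤ δ * (4 / 3) := by
    obtain ⟨h1, h2⟩ := hGF' x
    rw [hG] at h1 h2
    obtain ⟨h3, h4⟩ := hF01 x
    obtain ⟨h5, h6⟩ := hI₁ x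
    rw [abs_le]
    constructor <;> nlinarith
  refine ⟨⟨F', hL', fun x => ?_, fun x => ?_⟩, ?_, hsep⟩
  · obtain ⟨h1, h2⟩ := hGF' x
    rw [hG] at h1 h2
    obtain ⟨h3, h4⟩ := hF01 x
    obtain ⟨h5, h6⟩ := hI₁ x
    constructor <;> nlinarith
  · rw [hfix x x.2, hG, hFh, hh₁]
    ring
  · rw [mem_ball, Subtype.dist_eq]
    refine ((ContinuousMap.dist_le (by positivity)).2 fun x => hb x).trans_lt ?_
    linarith

/-- Countably many of the local boxes `A p ×ˢ B p` cover the pairs to be separated, so Baire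
applies. -/
theorem exists_separating_extension [NormedSpace ℝ V] [ProperSpace V]
    [TopologicalSpace X] [CompactSpace X]
    [TopologicalSpace.MetrizableSpace X] [ContinuousVAdd V X]
    {h : AddAction.fixedPoints V X → ℝ}
    (hh : Continuous h) (hI : ∀ x, h x ∈ Icc (1 / 3 : ℝ) (2 / 3)) :
    ∃ F ∈ orbitLipschitzExtensions V h, ∀ x y : X, x ≠ y → x ∉ AddAction.fixedPoints V X →
      ∃ t : V, F (t +ᵥ x) ≠ F (t +ᵥ y) := by
  let _ := TopologicalSpace.metrizableSpaceMetric X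
  let S : Set (X × X) := {p | p.1 ≠ p.2 ∧ p.1 ∉ AddAction.fixedPoints V X}
  have hloc (p : X × X) (hp : p ∈ S) := exists_nhds_separating_perturbation (V := V) hp.1 hp.2
  choose! A hA B hB hAc hBc hAB using hloc
  obtain ⟨T, hTS, hT, hcov⟩ := TopologicalSpace.countable_cover_nhdsWithin
    (f := fun p => A p ×ˢ B p) (s := S)
    fun p hp => mem_nhdsWithin_of_mem_nhds (prod_mem_nhds (hA p hp) (hB p hp))
  have : CompleteSpace (orbitLipschitzExtensions V h) :=
    (isClosed_orbitLipschitzExtensions h).completeSpace_coe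
  have hdense := dense_biInter_of_isOpen
    (f := fun p => {F : orbitLipschitzExtensions V h |
      ∀ x ∈ A p, ∀ y ∈ B p, ∃ t : V, F.1 (t +ᵥ x) ≠ F.1 (t +ᵥ y)})
    (fun p hp => (isOpen_setOf_separating (hAc p (hTS hp)).isCompact
      (hBc p (hTS hp)).isCompact).preimage continuous_subtype_val) hT
    (fun p hp => dense_separating hh hI (hAB p (hTS hp)))
  obtain ⟨F₁, hL₁, hI₁, hh₁⟩ := exists_orbitLipschitz_half_extension hh hI
  have : Nonempty (orbitLipschitzExtensions V h) := by
    refine ⟨F₁, fun t x => ?_, fun x => ?_, hh₁⟩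
    · have := hL₁ t x
      have := norm_nonneg t
      linarith
    · have := hI₁ x
      exact ⟨by linarith [this.1], by linarith [this.2]⟩
  obtain ⟨F, hF⟩ := hdense.nonempty
  refine ⟨F.1, F.2, fun x y hxy hx => ?_⟩
  obtain ⟨p, hp, hpxy⟩ := mem_iUnion₂.1 (hcov (show (x, y) ∈ S from ⟨hxy, hx⟩))
  exact mem_iInter₂.1 hF p hp x hpxy.1 y hpxy.2

end Flow

/-! ### The embedding -/

/-- The equivariant map into `LipOne n` induced by a function on `X`. -/
def orbitFunction {n : ℕ} {X : Type*} [TopologicalSpace X]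
    [AddAction (EuclideanSpace ℝ (Fin n)) X] [ContinuousVAdd (EuclideanSpace ℝ (Fin n)) X]
    (F : C(X, ℝ)) (hL : OrbitLipschitz (EuclideanSpace ℝ (Fin n)) 1 F)
    (h01 : ∀ x, F x ∈ Set.Icc (0 : ℝ) 1) (x : X) : LipOne n :=
  ⟨⟨fun t => ⟨F (t +ᵥ x), h01 _⟩, by fun_prop⟩, by
    refine LipschitzWith.of_dist_le_mul fun s t => ?_
    have h1 := hL.sub_le s t x
    have h2 := hL.sub_le t s x
    rw [norm_sub_rev] at h2
    change |F (s +ᵥ x) - F (t +ᵥ x)| ≤ _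
    rw [dist_eq_norm, NNReal.coe_one]
    exact abs_le.2 ⟨by linarith, h1⟩⟩

theorem continuous_orbitFunction {n : ℕ} {X : Type*} [TopologicalSpace X]
    [AddAction (EuclideanSpace ℝ (Fin n)) X] [ContinuousVAdd (EuclideanSpace ℝ (Fin n)) X]
    (F : C(X, ℝ)) (hL : OrbitLipschitz (EuclideanSpace ℝ (Fin n)) 1 F)
    (h01 : ∀ x, F x ∈ Set.Icc (0 : ℝ) 1) : Continuous (orbitFunction F hL h01) := by
  refine Continuous.subtype_mk (ContinuousMap.continuous_of_continuous_uncurry _ ?_) _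
  change Continuous fun p : X × EuclideanSpace ℝ (Fin n) =>
    (⟨F (p.2 +ᵥ p.1), h01 _⟩ : unitInterval)
  fun_prop

theorem mainTheorem1 (n : ℕ) (X : Type*) [TopologicalSpace X] [CompactSpace X]
    [TopologicalSpace.MetrizableSpace X] [AddAction (EuclideanSpace ℝ (Fin n)) X]
    [ContinuousVAdd (EuclideanSpace ℝ (Fin n)) X] :
    EquivariantlyEmbedsInLipOne n X ↔
      ∃ g : AddAction.fixedPoints (EuclideanSpace ℝ (Fin n)) X → unitInterval,
        IsEmbedding g := by
  constructor
  · rintro ⟨f, hf, heq⟩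
    have : CompactSpace (AddAction.fixedPoints (EuclideanSpace ℝ (Fin n)) X) :=
      isCompact_iff_compactSpace.1 isClosed_addAction_fixedPoints.isCompact
    refine ⟨fun x => (f x).1 0, (Continuous.isClosedEmbedding ?_ ?_).isEmbedding⟩
    · exact (continuous_eval_const (F := C(EuclideanSpace ℝ (Fin n), unitInterval)) 0).comp
        (continuous_subtype_val.comp (hf.continuous.comp continuous_subtype_val))
    · have hconst (x : AddAction.fixedPoints (EuclideanSpace ℝ (Fin n)) X)
          (t : EuclideanSpace ℝ (Fin n)) : (f x).1 t = (f x).1 0 := by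
        have h := congrArg (fun φ : LipOne n => φ.1 0) (heq t x)
        rw [x.2 t] at h
        rw [h]
        simp [LipOne.shift]
      intro x y hxy
      refine Subtype.ext (hf.injective (Subtype.ext (ContinuousMap.ext fun t => ?_)))
      rw [hconst x t, hconst y t]
      exact hxy
  · rintro ⟨g, hg⟩
    obtain ⟨F, ⟨hL, h01, hFh⟩, hsep⟩ := exists_separating_extension
      (V := EuclideanSpace ℝ (Fin n)) (X := X)
      -- Squeezing `g` into the middle third leaves room for the perturbations.
      (h := fun x => 1 / 3 + (g x : ℝ) / 3)
      (continuous_const.add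
        ((continuous_subtype_val.comp hg.continuous).div_const 3))
      fun x => ⟨by linarith [(g x).2.1], by linarith [(g x).2.2]⟩
    refine ⟨orbitFunction F hL h01,
      ((continuous_orbitFunction F hL h01).isClosedEmbedding fun x y hxy => ?_).isEmbedding,
      fun t x => ?_⟩
    · have hval (t : EuclideanSpace ℝ (Fin n)) : F (t +ᵥ x) = F (t +ᵥ y) :=
        congrArg (fun φ : LipOne n => ((φ.1 t : unitInterval) : ℝ)) hxy
      by_contra hne
      by_cases hx : x ∈ AddAction.fixedPoints (EuclideanSpace ℝ (Fin n)) X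
      · by_cases hy : y ∈ AddAction.fixedPoints (EuclideanSpace ℝ (Fin n)) X
        · have h0 := hval 0
          rw [zero_vadd, zero_vadd, hFh ⟨x, hx⟩, hFh ⟨y, hy⟩] at h0
          have : g ⟨x, hx⟩ = g ⟨y, hy⟩ := Subtype.ext (by linarith)
          exact hne (congrArg Subtype.val (hg.injective this))
        · obtain ⟨t, ht⟩ := hsep y x (Ne.symm hne) hy
          exact ht (hval t).symm
      · obtain ⟨t, ht⟩ := hsep x y hne hx
        exact ht (hval t)
    · refine Subtype.ext (ContinuousMap.ext fun s => Subtype.ext ?_)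
      change F (s +ᵥ (t +ᵥ x)) = F ((s + t) +ᵥ x)
      rw [vadd_vadd]
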